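/- Let $\overline a=(a_1,\dots,a_\ell)$ be a sequence of nonnegative integers with sum $n$, let $P_{\overline a}$ be the disjoint union of pairwise incomparable chains of sizes $a_1,\dots,a_\ell$, and let $\mathcal L(P_{\overline a})$ be its set of linear extensions $\sigma=[\sigma_1,\dots,\sigma_n]$. Definitions. Replacing each entry of a linear extension by the index of the chain containing it identifies $\mathcal L(P_{\overline a})$ with the set of permutations (rearrangements) of the multiset $\{1^{a_1},\dots,\ell^{a_\ell}\}$. A multiset permutation is written in two-line notation, with its weakly increasing rearrangement as the top line. The intercalation product of two multiset permutations is obtained by juxtaposing their two-line notations and sorting the columns by their top entries without interchanging columns that have the same top entry. A nonempty multiset permutation is a prime cycle if it is not an intercalation product of two nonempty ones. By Foata's theorem every multiset permutation $\sigma$ is an intercalation product of prime cycles, and the number of factors depends only on $\sigma$; this number is $\mathrm{fcyc}(\sigma)$, and for a linear extension $\mathrm{fcyc}$ is that of the corresponding multiset permutation. For a finite poset $P$, a permutation $\tau$ of the elements of $P$ is $P$-transverse if, with $\pi$ denoting the equivalence relation whose classes are the cycles of $\tau$, whenever $i<_P j$ the pair $(j,i)$ is not in the transitive closure of the relation $\{(x,y):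 x\le_P y\}\cup\pi$. Let $\mathrm{cyc}(\tau)$ be the number of cycles of $\tau$, fixed points included. The Poincaré polynomial of $P$ is $$\mathrm{Poin}(P,t)=\sum_X|\mu(V,X)|\,t^{\operatorname{codim}X},$$ where $V=\mathbb R^P$, $X$ runs over the intersections of hyperplanes $\{x_i=x_j\}$ ($i\ne j$ in $P$), including $V$ itself, that meet the open cone $\{x\in V: x_i<x_j\text{ whenever }i<_Pj\}$, and $\mu$ is the Möbius function of the poset of all intersections of these hyperplanes, ordered by reverse inclusion. Theorem. The identification of $\mathcal L(P_{\overline a})$ with the multiset permutations of $\{1^{a_1},\dots,\ell^{a_\ell}\}$ is a bijection, the number $\mathrm{fcyc}(\sigma)$ is well defined for all $\sigma\in\mathcal L(P_{\overline a})$, and there is a bijection $\sigma\mapsto\tau$ from $\mathcal L(P_{\overline a})$ to the set of $P_{\overline a}$-transverse permutations such that $\mathrm{cyc}(\tau)=\mathrm{fcyc}(\sigma)$ for every $\sigma$. Consequently $$\mathrm{Poin}(P_{\overline a},t)=\sum_{\sigma\in\mathcal L(P_{\overline a})}t^{\,n-\mathrm{fcyc}(\sigma)}.$$ -/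

import Mathlib

open Polynomial

noncomputable section

/-! ### Linear hyperplane arrangements, cones and Poincaré polynomials -/

section Arrangement

variable {E : Type*} [AddCommGroup E] [Module ℝ E]

/-- The intersection poset of an arrangement `A` of linear hyperplanes: all intersections of
subfamilies of `A` (the empty intersection being the whole space), ordered by reverse inclusion. -/
def IntersectionPoset (A : Set (Submodule ℝ E)) : Type _ :=
  {X : (Submodule ℝ E)ᵒᵈ // ∃ B ⊆ A, OrderDual.ofDual X = sInf B}

namespace IntersectionPoset

variable {A : Set (Submodule ℝ E)}

instance : PartialOrder (IntersectionPoset A) :=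
  inferInstanceAs (PartialOrder {X : (Submodule ℝ E)ᵒᵈ // ∃ B ⊆ A, OrderDual.ofDual X = sInf B})

/-- The subspace underlying an element of the intersection poset. -/
def space (X : IntersectionPoset A) : Submodule ℝ E := OrderDual.ofDual X.1

/-- The bottom element of the intersection poset: the ambient space. -/
def ambient : IntersectionPoset A :=
  ⟨OrderDual.toDual ⊤, ∅, Set.empty_subset A, by simp⟩

theorem finite (hA : A.Finite) : Finite (IntersectionPoset A) := by
  have : Finite {B : Set (Submodule ℝ E) // B ⊆ A} := hA.finite_subsets.to_subtype
  refine Finite.of_surjective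
    (fun B : {B : Set (Submodule ℝ E) // B ⊆ A} =>
      (⟨OrderDual.toDual (sInf B.1), B.1, B.2, rfl⟩ : IntersectionPoset A)) ?_
  rintro ⟨X, B, hB, hX⟩
  exact ⟨⟨B, hB⟩, Subtype.ext hX.symm⟩

instance [Finite A] : Fintype (IntersectionPoset A) :=
  have := finite (Set.toFinite A)
  Fintype.ofFinite _

instance : DecidableEq (IntersectionPoset A) := Classical.decEq _

instance [Finite A] : LocallyFiniteOrder (IntersectionPoset A) := by
  classical exact Fintype.toLocallyFiniteOrder

/-- The codimension `dim V - dim X`. -/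
def codim (X : IntersectionPoset A) : ℕ := Module.finrank ℝ E - Module.finrank ℝ X.space

end IntersectionPoset

open scoped Classical in
/-- The `k`-th signless Whitney number of a cone `K`: the sum of `|μ(V, X)|` over all `X` of
codimension `k` in the intersection poset of `A` that meet `K`. -/
def whitney (A : Set (Submodule ℝ E)) [Finite A] (K : Set E) (k : ℕ) : ℤ :=
  ∑ X : IntersectionPoset A with ((X.space : Set E) ∩ K).Nonempty ∧ X.codim = k,
    |IncidenceAlgebra.mu ℤ IntersectionPoset.ambient X|

/-- The Poincaré polynomial of a cone `K` of the arrangement `A`. -/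
def poincareCone (A : Set (Submodule ℝ E)) [Finite A] (K : Set E) : ℤ[X] :=
  ∑ k ∈ Finset.range (Module.finrank ℝ E + 1), C (whitney A K k) * X ^ k

end Arrangement

/-! ### Posets: braid cones, linear extensions, transverse permutations -/

section Poset

/-- The hyperplane `x_i = x_j`. -/
def braidHyperplane {P : Type*} (i j : P) : Submodule ℝ (P → ℝ) where
  carrier := {x | x i = x j}
  add_mem' := by
    intro x y hx hy
    change x i + y i = x j + y j
    rw [show x i = x j from hx, show y i = y j from hy]
  zero_mem' := rfl
  smul_mem' := by
    intro c x hx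
    change c • x i = c • x j
    rw [show x i = x j from hx]

/-- The braid arrangement, with coordinates indexed by `P`. -/
def braidArrangement (P : Type*) : Set (Submodule ℝ (P → ℝ)) :=
  {H | ∃ i j : P, i ≠ j ∧ H = braidHyperplane i j}

instance (P : Type*) [Finite P] : Finite (braidArrangement P) := by
  refine Set.Finite.subset
    (Set.finite_range (fun p : P × P => braidHyperplane p.1 p.2)) ?_
  rintro H ⟨i, j, -, rfl⟩
  exact ⟨(i, j), rfl⟩

/-- The open cone of a poset. -/
def posetCone (P : Type*) [PartialOrder P] : Set (P → ℝ) :=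
  {x | ∀ i j : P, i < j → x i < x j}

/-- The Poincaré polynomial of a finite poset. -/
def poin (P : Type*) [Finite P] [PartialOrder P] : ℤ[X] :=
  poincareCone (braidArrangement P) (posetCone P)

/-- Linear extensions `σ = [σ_1, …, σ_n]` of a poset with `n` elements: listings of all its
elements in which smaller elements come first. -/
def LinExt (n : ℕ) (P : Type*) [PartialOrder P] : Type _ :=
  {σ : Fin n ≃ P // ∀ x y : P, x < y → σ.symm x < σ.symm y}

instance (n : ℕ) (P : Type*) [PartialOrder P] : Finite (LinExt n P) :=
  inferInstanceAs (Finite {σ : Fin n ≃ P // ∀ x y : P, x < y → σ.symm x < σ.symm y})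

instance (n : ℕ) (P : Type*) [PartialOrder P] : Fintype (LinExt n P) := Fintype.ofFinite _

/-- A set partition `π` of `P` is `P`-transverse if `i <_P j` implies that `(j, i)` does not lie
in the transitive closure of `P ∪ π`. -/
def IsTransversePartition {P : Type*} [PartialOrder P] (π : Setoid P) : Prop :=
  ∀ i j : P, i < j → ¬ Relation.TransGen (fun x y => x ≤ y ∨ π x y) j i

/-- `P`-transverse permutations: those whose cycles form a `P`-transverse partition. -/
def TransversePerm (P : Type*) [PartialOrder P] : Type _ :=
  {τ : Equiv.Perm P // IsTransversePartition (Equiv.Perm.SameCycle.setoid τ)}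

/-- The number of cycles of a permutation, fixed points included. -/
def cyc {P : Type*} (τ : Equiv.Perm P) : ℕ :=
  Nat.card (Quotient (Equiv.Perm.SameCycle.setoid τ))

end Poset

end

/-! ### Multiset permutations and the intercalation product

A multiset permutation with letters in `Fin ℓ` is a word in these letters; the multiset that it
permutes is the multiset of its letters. -/

section Intercalation

variable {ℓ : ℕ}

/-- The two-line notation, as a list of columns `(top, bottom)`: the top line is the weakly
increasing rearrangement of the word, the bottom line is the word itself. -/
def twoLine (σ : List (Fin ℓ)) : List (Fin ℓ × Fin ℓ) :=
  (σ.insertionSort (· ≤ ·)).zip σ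

/-- The intercalation product: juxtapose the two-line notations, sort the columns stably
by their top entries (insertion sort never interchanges two columns with the same top entry),
and read off the bottom line. -/
def intercalation (σ ρ : List (Fin ℓ)) : List (Fin ℓ) :=
  ((twoLine σ ++ twoLine ρ).insertionSort (fun c d => c.1 ≤ d.1)).map Prod.snd

/-- Prime multiset permutations (the empty one, which is the unit, is not prime). -/
def IsPrimeCycle (σ : List (Fin ℓ)) : Prop :=
  σ ≠ [] ∧ ∀ ρ τ : List (Fin ℓ), σ = intercalation ρ τ → ρ = [] ∨ τ = []

/-- `L = [σ⁽¹⁾, …, σ⁽ᵏ⁾]` is a decomposition of `σ` as an intercalation product of primes. -/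
def IsPrimeDecomposition (σ : List (Fin ℓ)) (L : List (List (Fin ℓ))) : Prop :=
  (∀ c ∈ L, IsPrimeCycle c) ∧ σ = L.foldr intercalation []

/-- The number of prime cycles in a decomposition of `σ` into prime cycles (formally the least such
number; that a decomposition exists and that all have the same number of factors is
Foata's theorem). -/
noncomputable def fcyc (σ : List (Fin ℓ)) : ℕ :=
  sInf {k | ∃ L, IsPrimeDecomposition σ L ∧ L.length = k}

/-- The multiset permutations of the multiset in which `i` has multiplicity `a i`. -/
def multisetPerms (a : Fin ℓ → ℕ) : Set (List (Fin ℓ)) :=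
  {w | ∀ i, w.count i = a i}

/-- The disjoint union of chains of sizes `a i`; elements of different chains are incomparable
(this is the order that a sigma type carries). -/
abbrev ChainUnion (a : Fin ℓ → ℕ) : Type := Σ i : Fin ℓ, Fin (a i)

/-- The multiset permutation of a linear extension: replace each element by the
index of its chain. -/
def multisetWord {n : ℕ} {a : Fin ℓ → ℕ} (σ : LinExt n (ChainUnion a)) : List (Fin ℓ) :=
  List.ofFn (fun k => (σ.1 k).1)

end Intercalation

/-!
The signs of the permutations whose fixed space contains an intersection `X ≠ V` of hyperplanes
cancel, by composing with a transposition that fixes `X` pointwise. Hence `μ(V, X)` is the sum of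
the signs of the permutations with fixed space `X`; these signs all agree, so `|μ(V, X)|` counts
these permutations. Since `X` meets the cone of `P` exactly when they are transverse, the Poincaré
polynomial counts transverse permutations by cycles.

A permutation is transverse exactly when some strictly monotone height is constant on its cycles.
Heights of two transverse permutations of a union of chains can be compared lexicographically,
which shows that a transverse `τ` is determined by the chains to which it sends the elements, that
is, by a multiset permutation in two-line notation. Conversely, a prime multiset permutation is a
cycle on a set of letters, and the successive factors of an intercalation product of primes are the
cycles, of increasing height, of a transverse permutation. Since the latter depends only on the
product, so does the number of factors.
-/

section Transverse

theorem sameCycle_map {α β : Type*} {f : α → β} {σ : Equiv.Perm α} {τ : Equiv.Perm β}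
    (h : Function.Semiconj f σ τ) {x y : α} (hxy : σ.SameCycle x y) :
    τ.SameCycle (f x) (f y) := by
  have hpow (n : ℕ) (z : α) : f ((σ ^ n) z) = (τ ^ n) (f z) := by
    simpa only [Equiv.Perm.iterate_eq_pow] using h.iterate_right n z
  obtain ⟨k, rfl⟩ := hxy
  refine ⟨k, ?_⟩
  obtain ⟨n, rfl | rfl⟩ := k.eq_nat_or_neg
  · simp only [zpow_natCast, hpow]
  · rw [zpow_neg, zpow_neg, zpow_natCast, zpow_natCast, Equiv.Perm.inv_eq_iff_eq, ← hpow,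
      ← Equiv.Perm.mul_apply, mul_inv_cancel, Equiv.Perm.one_apply]

theorem apply_eq_of_sameCycle {P α : Type*} {τ : Equiv.Perm P} {h : P → α}
    (hτ : ∀ x, h (τ x) = h x) {x y : P} (hxy : τ.SameCycle x y) : h x = h y :=
  Equiv.Perm.sameCycle_one.1 (sameCycle_map (τ := 1) hτ hxy)

variable {P : Type*} [PartialOrder P]

theorem IsTransversePartition.of_strictMono {α : Type*} [Preorder α] {π : Setoid P} {h : P → α}
    (hh : StrictMono h) (hπ : ∀ x y, π x y → h x = h y) : IsTransversePartition π := by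
  intro i j hij hji
  have hle : Relation.TransGen (· ≤ ·) (h j) (h i) :=
    hji.lift h fun x y hxy => hxy.elim (fun hle => hh.monotone hle) fun hr => (hπ x y hr).le
  rw [Relation.transGen_eq_self] at hle
  exact (hh hij).not_ge hle

theorem IsTransversePartition.exists_strictMono [Finite P] {π : Setoid P}
    (hπ : IsTransversePartition π) :
    ∃ h : P → ℕ, StrictMono h ∧ ∀ x y, π x y → h x = h y := by
  let r : P → P → Prop := fun x y => x ≤ y ∨ π x y
  let below (x : P) : Set P := {y | Relation.ReflTransGen r y x}
  have below_mono {x y : P} (hxy : r x y) : below x ⊆ below y := fun _ hz => hz.tail hxy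
  refine ⟨fun x => (below x).ncard, fun x y hxy => Set.ncard_lt_ncard ?_ (Set.toFinite _),
    fun x y hxy => ?_⟩
  · refine (below_mono (Or.inl hxy.le)).ssubset_of_mem_notMem
      (a := y) Relation.ReflTransGen.refl fun hyx => ?_
    rcases Relation.reflTransGen_iff_eq_or_transGen.1 hyx with h | h
    · exact hxy.ne h
    · exact hπ x y hxy h
  · exact congrArg Set.ncard
      ((below_mono (Or.inr hxy)).antisymm (below_mono (Or.inr (π.symm hxy))))

/-- Where `τ x < τ' x`, the height `h'` drops from `x` to `τ x` while `h` is constant; so the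
lexicographic height of `τ x` or of `τ' x` drops wherever `τ` and `τ'` differ. -/
theorem perm_eq_of_strictMono_invariant [Finite P] {α β : Type*} [Preorder α] [Preorder β]
    {τ τ' : Equiv.Perm P} {h : P → α} {h' : P → β}
    (hh : StrictMono h) (hτ : ∀ x, h (τ x) = h x)
    (hh' : StrictMono h') (hτ' : ∀ x, h' (τ' x) = h' x)
    (hcomp : ∀ x, τ x ≤ τ' x ∨ τ' x ≤ τ x) : τ = τ' := by
  let H (x : P) : α ×ₗ β := toLex (h x, h' x)
  have hwf : WellFounded (InvImage (· < ·) H) := Finite.wellFounded_of_trans_of_irrefl _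
  ext x
  induction x using hwf.induction with
  | _ x ih =>
  have hinv (y : P) (hy : H y < H x) : H (τ y) = H y ∧ H (τ' y) = H y := by
    have hττ' : τ y = τ' y := ih y hy
    have hτy : H (τ y) = H y :=
      congrArg toLex (Prod.ext (hτ y) ((congrArg h' hττ').trans (hτ' y)))
    exact ⟨hτy, hττ' ▸ hτy⟩
  have not_lt : ∀ ρ : Equiv.Perm P, (∀ y, H y < H x → H (ρ y) = H y) → ¬ H (ρ x) < H x := by
    intro ρ hρ hlt
    have hmaps : ∀ y, H y < H x → H (ρ y) < H x := fun y hy => (hρ y hy).trans_lt hy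
    have := Equiv.Perm.perm_symm_on_of_perm_on_finite (p := fun y => H y < H x) hmaps hlt
    simp at this
  rcases hcomp x with hle | hle
  · by_contra hne
    refine not_lt τ (fun y hy => (hinv y hy).1) (Prod.Lex.toLex_lt_toLex.2 (Or.inr ⟨hτ x, ?_⟩))
    exact (hh' (lt_of_le_of_ne hle hne)).trans_eq (hτ' x)
  · by_contra hne
    refine not_lt τ' (fun y hy => (hinv y hy).2) (Prod.Lex.toLex_lt_toLex.2 (Or.inl ?_))
    exact (hh (lt_of_le_of_ne hle (Ne.symm hne))).trans_eq (hτ x)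

theorem TransversePerm.eq_of_comparable [Finite P] {τ τ' : TransversePerm P}
    (hcomp : ∀ x, τ.1 x ≤ τ'.1 x ∨ τ'.1 x ≤ τ.1 x) : τ = τ' := by
  obtain ⟨h, hh, hτ⟩ := τ.2.exists_strictMono
  obtain ⟨h', hh', hτ'⟩ := τ'.2.exists_strictMono
  exact Subtype.ext (perm_eq_of_strictMono_invariant hh (fun x => hτ _ _ ⟨-1, by simp⟩)
    hh' (fun x => hτ' _ _ ⟨-1, by simp⟩) hcomp)

end Transverse

section Cycles

theorem cyc_eq_natCard_of_sameCycle_iff {P β : Type*} {τ : Equiv.Perm P} {f : P → β}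
    (hf : Function.Surjective f) (h : ∀ x y, τ.SameCycle x y ↔ f x = f y) :
    cyc τ = Nat.card β := by
  have hker : Equiv.Perm.SameCycle.setoid τ = Setoid.ker f := Setoid.ext h
  rw [cyc, hker]
  exact Nat.card_congr (Setoid.quotientKerEquivOfSurjective f hf)

variable {P : Type*} [Fintype P] [DecidableEq P]

theorem image_cycleOf_support (τ : Equiv.Perm P) :
    τ.support.image τ.cycleOf = τ.cycleFactorsFinset := by
  ext c
  rw [Finset.mem_image]
  constructor
  · rintro ⟨x, hx, rfl⟩
    exact Equiv.Perm.cycleOf_mem_cycleFactorsFinset_iff.2 hx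
  · intro hc
    obtain ⟨x, hx⟩ := (Equiv.Perm.mem_cycleFactorsFinset_iff.1 hc).1.nonempty_support
    exact ⟨x, Equiv.Perm.mem_cycleFactorsFinset_support_le hc hx,
      (Equiv.Perm.cycle_is_cycleOf hx hc).symm⟩

theorem cyc_add_card_support (τ : Equiv.Perm P) :
    cyc τ + τ.support.card = Fintype.card P + τ.cycleFactorsFinset.card := by
  classical
  let cycle : P → Quotient (Equiv.Perm.SameCycle.setoid τ) := Quotient.mk _
  have hsame {x y : P} (h : cycle x = cycle y) : τ.SameCycle x y := Quotient.exact h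
  have hcyc : cyc τ = (τ.support.image cycle).card + (τ.supportᶜ.image cycle).card := by
    have hdisj : Disjoint (τ.support.image cycle) (τ.supportᶜ.image cycle) := by
      rw [Finset.disjoint_left]
      intro c hc hc'
      obtain ⟨x, hx, rfl⟩ := Finset.mem_image.1 hc
      obtain ⟨y, hy, hyx⟩ := Finset.mem_image.1 hc'
      rw [Equiv.Perm.mem_support] at hx
      rw [Finset.mem_compl, Equiv.Perm.notMem_support] at hy
      exact hx ((hsame hyx).apply_eq_self_iff.1 hy)
    rw [← Finset.card_union_of_disjoint hdisj, ← Finset.image_union, Finset.union_compl,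
      Finset.image_univ_of_surjective Quotient.mk_surjective, Finset.card_univ, cyc,
      Nat.card_eq_fintype_card]
  have hfixed : (τ.supportᶜ.image cycle).card = τ.supportᶜ.card := by
    refine Finset.card_image_of_injOn fun x hx y _ hxy => ?_
    exact (hsame hxy).eq_of_left (Equiv.Perm.notMem_support.1 (Finset.mem_compl.1 hx))
  have hmoved : (τ.support.image cycle).card = τ.cycleFactorsFinset.card := by
    let toPerm : Quotient (Equiv.Perm.SameCycle.setoid τ) → Equiv.Perm P :=
      Quotient.lift τ.cycleOf fun x y h => Equiv.Perm.SameCycle.cycleOf_eq h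
    have hinj : Set.InjOn toPerm (τ.support.image cycle) := by
      intro c hc d hd hcd
      obtain ⟨x, hx, rfl⟩ := Finset.mem_image.1 hc
      obtain ⟨y, hy, rfl⟩ := Finset.mem_image.1 hd
      exact Quotient.sound ((Equiv.Perm.sameCycle_iff_cycleOf_eq_of_mem_support hx hy).2 hcd)
    rw [← image_cycleOf_support, ← Finset.card_image_of_injOn hinj, Finset.image_image]
    rfl
  have hcompl := τ.support.card_add_card_compl
  omega

theorem sign_eq_neg_one_pow_cyc (τ : Equiv.Perm P) :
    (Equiv.Perm.sign τ : ℤ) = (-1) ^ (Fintype.card P + cyc τ) := by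
  have hcard : τ.cycleType.card = τ.cycleFactorsFinset.card := by simp [Equiv.Perm.cycleType]
  rw [Equiv.Perm.sign_of_cycleType, Equiv.Perm.sum_cycleType, hcard, Units.val_pow_eq_pow_val,
    Units.coe_neg_one]
  refine neg_one_pow_congr ?_
  have := cyc_add_card_support τ
  rw [Nat.even_iff, Nat.even_iff]
  omega

theorem sum_sign_eq_zero_of_swap_mul_mem {i j : P} (hij : i ≠ j) {s : Finset (Equiv.Perm P)}
    (hs : ∀ τ ∈ s, Equiv.swap i j * τ ∈ s) : ∑ τ ∈ s, (Equiv.Perm.sign τ : ℤ) = 0 := by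
  refine Finset.sum_involution (fun τ _ => Equiv.swap i j * τ) ?_ ?_ hs ?_
  · intro τ _
    simp [Equiv.Perm.sign_mul, Equiv.Perm.sign_swap hij]
  · intro τ _ _ h
    exact hij (Equiv.swap_eq_one_iff.1 (mul_eq_right.1 h))
  · intro τ _
    exact Equiv.swap_mul_self_mul i j τ

end Cycles

section Arrangement

variable {E : Type*} [AddCommGroup E] [Module ℝ E] {A : Set (Submodule ℝ E)}

namespace IntersectionPoset

theorem ambient_le (X : IntersectionPoset A) : ambient ≤ X :=
  (le_top : X.space ≤ ⊤)

theorem space_injective : Function.Injective (space : IntersectionPoset A → Submodule ℝ E) :=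
  Subtype.val_injective

theorem exists_space_le_of_ne_ambient {X : IntersectionPoset A} (hX : X ≠ ambient) :
    ∃ H ∈ A, X.space ≤ H := by
  obtain ⟨B, hBA, hXB⟩ := X.2
  have hB : B.Nonempty := by
    rw [Set.nonempty_iff_ne_empty]
    rintro rfl
    exact hX (space_injective (hXB.trans sInf_empty))
  obtain ⟨H, hH⟩ := hB
  exact ⟨H, hBA hH, hXB.trans_le (sInf_le hH)⟩

end IntersectionPoset

open scoped Classical in
theorem poincareCone_eq_sum [Finite A] (K : Set E) :
    poincareCone A K = ∑ X : IntersectionPoset A with ((X.space : Set E) ∩ K).Nonempty,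
      C |IncidenceAlgebra.mu ℤ IntersectionPoset.ambient X| * (Polynomial.X : ℤ[X]) ^ X.codim := by
  have hcodim (X : IntersectionPoset A) :
      X.codim ∈ Finset.range (Module.finrank ℝ E + 1) :=
    Finset.mem_range.2 (Nat.lt_succ_of_le (Nat.sub_le _ _))
  rw [poincareCone, ← Finset.sum_fiberwise_of_maps_to (fun X _ => hcodim X)]
  refine Finset.sum_congr rfl fun k _ => ?_
  rw [whitney, map_sum, Finset.sum_mul, Finset.filter_filter]
  refine Finset.sum_congr rfl fun X hX => ?_
  rw [(Finset.mem_filter.1 hX).2.2]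

end Arrangement

theorem incidenceMu_eq_of_sum_Icc_eq {𝕜 α : Type*} [AddCommGroup 𝕜] [One 𝕜] [PartialOrder α]
    [LocallyFiniteOrder α] [DecidableEq α] {x : α} {f : α → 𝕜}
    (hf : ∀ y, x ≤ y → ∑ z ∈ Finset.Icc x y, f z = if x = y then 1 else 0) {y : α} (hxy : x ≤ y) :
    IncidenceAlgebra.mu 𝕜 x y = f y := by
  induction hn : (Finset.Icc x y).card using Nat.strong_induction_on generalizing y with
  | _ n ih =>
  have hmu := (IncidenceAlgebra.sum_Icc_mu_right (𝕜 := 𝕜) x y).trans (hf y hxy).symm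
  rw [← Finset.Ico_insert_right hxy, Finset.sum_insert Finset.right_notMem_Ico,
    Finset.sum_insert Finset.right_notMem_Ico] at hmu
  have hlt : ∑ z ∈ Finset.Ico x y, IncidenceAlgebra.mu 𝕜 x z = ∑ z ∈ Finset.Ico x y, f z := by
    refine Finset.sum_congr rfl fun z hz => ?_
    obtain ⟨hxz, hzy⟩ := Finset.mem_Ico.1 hz
    exact ih _ (hn ▸ Finset.card_lt_card (Finset.Icc_ssubset_Icc_right hxy le_rfl hzy)) hxz rfl
  rw [hlt] at hmu
  exact add_right_cancel hmu

section Braid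

variable {P : Type*}

/-- The space of real functions on `P` that are constant on the blocks of `π`. -/
def blockSpace (π : Setoid P) : Submodule ℝ (P → ℝ) :=
  LinearMap.range (LinearMap.funLeft ℝ ℝ (Quotient.mk π))

theorem mem_blockSpace {π : Setoid P} {x : P → ℝ} :
    x ∈ blockSpace π ↔ ∀ i j, π i j → x i = x j := by
  constructor
  · rintro ⟨y, rfl⟩ i j hij
    exact congrArg y (Quotient.sound hij)
  · intro hx
    exact ⟨Quotient.lift x hx, rfl⟩

theorem finrank_blockSpace [Finite P] (π : Setoid P) :
    Module.finrank ℝ (blockSpace π) = Nat.card (Quotient π) := by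
  have := Fintype.ofFinite (Quotient π)
  rw [blockSpace, LinearMap.finrank_range_of_inj
    (LinearMap.funLeft_injective_of_surjective ℝ ℝ _ Quotient.mk_surjective),
    Module.finrank_fintype_fun_eq_card, Nat.card_eq_fintype_card]

/-- The element of the intersection poset of the braid arrangement that belongs to the set
partition `π`: the intersection of the hyperplanes `x_i = x_j` with `i` and `j` in one block. -/
def partitionFlat (π : Setoid P) : IntersectionPoset (braidArrangement P) := by
  refine ⟨OrderDual.toDual (blockSpace π), {H | ∃ i j, i ≠ j ∧ π i j ∧ H = braidHyperplane i j},
    ?_, ?_⟩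
  · rintro H ⟨i, j, hij, -, rfl⟩
    exact ⟨i, j, hij, rfl⟩
  · ext x
    rw [OrderDual.ofDual_toDual, mem_blockSpace, Submodule.mem_sInf]
    constructor
    · rintro hx H ⟨i, j, -, hπ, rfl⟩
      exact hx i j hπ
    · intro hx i j hπ
      by_cases hij : i = j
      · exact congrArg x hij
      · exact hx _ ⟨i, j, hij, hπ, rfl⟩

theorem codim_partitionFlat [Finite P] (π : Setoid P) :
    (partitionFlat π).codim = Nat.card P - Nat.card (Quotient π) := by
  have := Fintype.ofFinite P
  rw [IntersectionPoset.codim, Module.finrank_fintype_fun_eq_card, Nat.card_eq_fintype_card]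
  exact congrArg _ (finrank_blockSpace π)

theorem partitionFlat_inter_posetCone_nonempty_iff [Finite P] [PartialOrder P] {π : Setoid P} :
    (((partitionFlat π).space : Set (P → ℝ)) ∩ posetCone P).Nonempty ↔
      IsTransversePartition π := by
  constructor
  · rintro ⟨x, hxπ, hx⟩
    exact .of_strictMono (h := x) (fun i j hij => hx i j hij) (mem_blockSpace.1 hxπ)
  · intro hπ
    obtain ⟨h, hh, hhπ⟩ := hπ.exists_strictMono
    exact ⟨fun i => h i, mem_blockSpace.2 fun i j hij => congrArg Nat.cast (hhπ i j hij),
      fun i j hij => Nat.cast_lt.2 (hh hij)⟩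

/-- The element of the intersection poset of the braid arrangement that belongs to the cycle
partition of `τ`. -/
def cycleFlat (τ : Equiv.Perm P) : IntersectionPoset (braidArrangement P) :=
  partitionFlat (Equiv.Perm.SameCycle.setoid τ)

theorem mem_cycleFlat {τ : Equiv.Perm P} {x : P → ℝ} :
    x ∈ (cycleFlat τ).space ↔ ∀ i, x (τ i) = x i :=
  mem_blockSpace.trans
    ⟨fun hx i => hx _ _ ⟨-1, by simp⟩, fun hx _ _ hij => apply_eq_of_sameCycle hx hij⟩

theorem cycleFlat_le_iff {τ : Equiv.Perm P} {X : IntersectionPoset (braidArrangement P)} :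
    cycleFlat τ ≤ X ↔ ∀ x ∈ X.space, ∀ i, x (τ i) = x i :=
  ⟨fun h _ hx => mem_cycleFlat.1 (h hx), fun h x hx => mem_cycleFlat.2 (h x hx)⟩

theorem cycleFlat_le_ambient_iff {τ : Equiv.Perm P} :
    cycleFlat τ ≤ IntersectionPoset.ambient ↔ τ = 1 := by
  classical
  rw [cycleFlat_le_iff]
  constructor
  · intro h
    refine Equiv.ext fun i => by_contra fun hi : τ i ≠ i => ?_
    have hsingle := h (Pi.single i 1) Submodule.mem_top i
    rw [Pi.single_eq_of_ne hi, Pi.single_eq_same] at hsingle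
    exact zero_ne_one hsingle
  · rintro rfl x - i
    rfl

theorem sum_sign_cycleFlat_le [Fintype P] [DecidableEq P]
    (X : IntersectionPoset (braidArrangement P)) [DecidablePred (cycleFlat (P := P) · ≤ X)] :
    ∑ τ : Equiv.Perm P with cycleFlat τ ≤ X, (Equiv.Perm.sign τ : ℤ) =
      if IntersectionPoset.ambient = X then 1 else 0 := by
  split_ifs with hX
  · subst hX
    have : ({τ : Equiv.Perm P | cycleFlat τ ≤ IntersectionPoset.ambient} : Finset _) = {1} := by
      ext τ
      rw [Finset.mem_filter_univ, cycleFlat_le_ambient_iff, Finset.mem_singleton]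
    rw [this, Finset.sum_singleton, Equiv.Perm.sign_one, Units.val_one]
  · obtain ⟨_, ⟨i, j, hij, rfl⟩, hXij⟩ :=
      IntersectionPoset.exists_space_le_of_ne_ambient (Ne.symm hX)
    refine sum_sign_eq_zero_of_swap_mul_mem hij fun τ hτ => ?_
    rw [Finset.mem_filter_univ, cycleFlat_le_iff] at hτ ⊢
    intro x hx k
    have hswap (m : P) : x (Equiv.swap i j m) = x m := by
      have hxij : x i = x j := hXij hx
      rw [Equiv.swap_apply_def]
      split_ifs with hi hj
      · rw [hi, hxij]
      · rw [hj, hxij]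
      · rfl
    exact (hswap (τ k)).trans (hτ x hx k)

theorem mu_ambient_eq_sum_sign [Fintype P] [DecidableEq P]
    (X : IntersectionPoset (braidArrangement P)) :
    IncidenceAlgebra.mu ℤ IntersectionPoset.ambient X =
      ∑ τ : Equiv.Perm P with cycleFlat τ = X, (Equiv.Perm.sign τ : ℤ) := by
  classical
  refine incidenceMu_eq_of_sum_Icc_eq (f := fun X => ∑ τ : Equiv.Perm P with cycleFlat τ = X,
    (Equiv.Perm.sign τ : ℤ)) (fun Y _ => ?_) X.ambient_le
  rw [← sum_sign_cycleFlat_le Y, ← Finset.sum_fiberwise_of_maps_to (g := cycleFlat)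
    (t := Finset.Icc IntersectionPoset.ambient Y)]
  · refine Finset.sum_congr rfl fun Z hZ => Finset.sum_congr ?_ fun _ _ => rfl
    ext τ
    simp only [Finset.mem_filter, Finset.mem_univ, true_and]
    exact ⟨fun h => ⟨h.trans_le (Finset.mem_Icc.1 hZ).2, h⟩, fun h => h.2⟩
  · intro τ hτ
    exact Finset.mem_Icc.2 ⟨IntersectionPoset.ambient_le _, (Finset.mem_filter.1 hτ).2⟩

theorem abs_mu_ambient [Fintype P] [DecidableEq P] (X : IntersectionPoset (braidArrangement P)) :
    |IncidenceAlgebra.mu ℤ IntersectionPoset.ambient X| =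
      ({τ : Equiv.Perm P | cycleFlat τ = X} : Finset _).card := by
  have hsign : ∀ τ ∈ ({τ : Equiv.Perm P | cycleFlat τ = X} : Finset _),
      (Equiv.Perm.sign τ : ℤ) = (-1) ^ X.codim := by
    intro τ hτ
    have hle : cyc τ ≤ Nat.card P := Nat.card_le_card_of_surjective _ Quotient.mk_surjective
    have hcodim : X.codim = Nat.card P - cyc τ := by
      rw [← (Finset.mem_filter_univ _).1 hτ]
      exact codim_partitionFlat _
    rw [sign_eq_neg_one_pow_cyc, ← Nat.card_eq_fintype_card, hcodim]
    refine neg_one_pow_congr ?_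
    rw [Nat.even_iff, Nat.even_iff]
    omega
  rw [mu_ambient_eq_sum_sign, Finset.sum_congr rfl hsign, Finset.sum_const, nsmul_eq_mul, abs_mul,
    abs_neg_one_pow, mul_one, Nat.abs_cast]

noncomputable instance [Finite P] [PartialOrder P] : Fintype (TransversePerm P) :=
  have : Finite (TransversePerm P) := Subtype.finite
  Fintype.ofFinite _

theorem poin_eq_sum_transversePerm [Finite P] [PartialOrder P] :
    poin P = ∑ τ : TransversePerm P, (X : ℤ[X]) ^ (Nat.card P - cyc τ.1) := by
  classical
  have := Fintype.ofFinite P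
  let flatsMeetingCone : Finset (IntersectionPoset (braidArrangement P)) :=
    {Y | ((Y.space : Set (P → ℝ)) ∩ posetCone P).Nonempty}
  have hmaps (τ : TransversePerm P) : cycleFlat τ.1 ∈ flatsMeetingCone :=
    (Finset.mem_filter_univ _).2 (partitionFlat_inter_posetCone_nonempty_iff.2 τ.2)
  rw [poin, poincareCone_eq_sum, ← Finset.sum_fiberwise_of_maps_to fun τ _ => hmaps τ]
  refine Finset.sum_congr rfl fun Y hY => ?_
  rw [abs_mu_ambient]
  have hfiber : ({τ : Equiv.Perm P | cycleFlat τ = Y} : Finset _).card =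
      ({τ : TransversePerm P | cycleFlat τ.1 = Y} : Finset _).card := by
    refine (Finset.card_bij (fun τ _ => τ.1) (fun τ hτ => ?_) (fun _ _ _ _ => Subtype.ext)
      fun τ hτ => ?_).symm
    · simpa only [Finset.mem_filter_univ] using hτ
    · have hτY : cycleFlat τ = Y := by simpa only [Finset.mem_filter_univ] using hτ
      have hτP := partitionFlat_inter_posetCone_nonempty_iff.1
        (hτY ▸ (Finset.mem_filter_univ _).1 hY)
      let τ' : TransversePerm P := ⟨τ, hτP⟩
      exact ⟨τ', by simpa only [Finset.mem_filter_univ] using hτY, rfl⟩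
  have hcodim : ∀ τ ∈ ({τ : TransversePerm P | cycleFlat τ.1 = Y} : Finset _),
      (X : ℤ[X]) ^ (Nat.card P - cyc τ.1) = X ^ Y.codim := by
    intro τ hτ
    rw [← (Finset.mem_filter_univ _).1 hτ, cycleFlat, codim_partitionFlat, cyc]
  rw [Finset.sum_congr rfl hcodim, Finset.sum_const, nsmul_eq_mul, hfiber, map_natCast]

end Braid

section Rows

theorem filter_insertionSort_of_pairwise {α : Type*} {r : α → α → Prop} [DecidableRel r]
    [Std.Total r] [IsTrans α r] {p : α → Bool} {l : List α} (h : (l.filter p).Pairwise r) :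
    (l.insertionSort r).filter p = l.filter p := by
  have hsub := (List.sublist_insertionSort h List.filter_sublist).filter p
  simp only [List.filter_filter, Bool.and_self] at hsub
  exact (hsub.eq_of_length ((List.perm_insertionSort r l).filter p).length_eq.symm).symm

theorem eq_of_filter_key_eq {α β : Type*} [PartialOrder α] [DecidableEq α] {f : β → α}
    {l l' : List β} (hl : l.Pairwise fun c d => f c ≤ f d) (hl' : l'.Pairwise fun c d => f c ≤ f d)
    (h : ∀ i, l.filter (f · = i) = l'.filter (f · = i)) : l = l' := by
  have mem_iff (x : β) : x ∈ l ↔ x ∈ l' := by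
    simpa [List.mem_filter] using congrArg (x ∈ ·) (h (f x))
  induction l generalizing l' with
  | nil => exact (List.eq_nil_iff_forall_not_mem.2 fun d hd => by simpa using (mem_iff d).2 hd).symm
  | cons c l ih =>
    cases l' with
    | nil => simpa using (mem_iff c).1 List.mem_cons_self
    | cons d l' =>
      have hle {x y : β} {s : List β} (hs : (x :: s).Pairwise fun c d => f c ≤ f d)
          (hy : y ∈ x :: s) : f x ≤ f y := by
        obtain rfl | hy := List.mem_cons.1 hy
        exacts [le_rfl, List.rel_of_pairwise_cons hs hy]
      have hcd : f c = f d :=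
        (hle hl ((mem_iff d).2 List.mem_cons_self)).antisymm
          (hle hl' ((mem_iff c).1 List.mem_cons_self))
      have hc := h (f c)
      rw [List.filter_cons_of_pos (by simp), List.filter_cons_of_pos (by simp [hcd]),
        List.cons.injEq] at hc
      obtain ⟨rfl, hc⟩ := hc
      have htail (i : α) : l.filter (f · = i) = l'.filter (f · = i) := by
        by_cases hi : f c = i
        · exact hi ▸ hc
        · simpa [hi] using h i
      rw [ih hl.of_cons hl'.of_cons htail fun x => ?_]
      simpa [List.mem_filter] using congrArg (x ∈ ·) (htail (f x))

theorem flatMap_eq_of_forall_ne {α β : Type*} {l : List α} {g : α → List β} {a : α}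
    (hl : l.Nodup) (ha : a ∈ l) (hg : ∀ b, b ≠ a → g b = []) : l.flatMap g = g a := by
  obtain ⟨s, t, rfl⟩ := List.append_of_mem ha
  obtain ⟨hs, ht⟩ : a ∉ s ∧ a ∉ t := by
    simp only [List.nodup_middle, List.nodup_cons, List.mem_append, not_or] at hl
    exact hl.1
  rw [List.flatMap_append, List.flatMap_cons,
    List.flatMap_eq_nil_iff.2 fun b hb => hg b (ne_of_mem_of_not_mem hb hs),
    List.flatMap_eq_nil_iff.2 fun b hb => hg b (ne_of_mem_of_not_mem hb ht),
    List.nil_append, List.append_nil]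

theorem sum_countP_filter_key {α β : Type*} [Fintype α] [DecidableEq α] (f : β → α)
    (p : β → Bool) (l : List β) : ∑ i, (l.filter (f · = i)).countP p = l.countP p := by
  rw [List.countP_eq_length_filter, ← List.length_map (f := f), ← Multiset.coe_card,
    ← Multiset.sum_count_eq_card fun i _ => Finset.mem_univ i]
  refine Finset.sum_congr rfl fun i _ => ?_
  rw [Multiset.coe_count, List.count, List.countP_map, List.countP_filter, List.countP_filter]
  refine List.countP_congr fun x _ => ?_
  simp [and_comm]

variable {ℓ : ℕ}

theorem map_fst_twoLine (w : List (Fin ℓ)) :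
    (twoLine w).map Prod.fst = w.insertionSort (· ≤ ·) :=
  List.map_fst_zip (List.length_insertionSort _ w).le

theorem map_snd_twoLine (w : List (Fin ℓ)) : (twoLine w).map Prod.snd = w :=
  List.map_snd_zip (List.length_insertionSort _ w).ge

theorem length_twoLine (w : List (Fin ℓ)) : (twoLine w).length = w.length := by
  rw [← List.length_map, map_snd_twoLine]

theorem pairwise_fst_twoLine (w : List (Fin ℓ)) :
    (twoLine w).Pairwise fun c d => c.1 ≤ d.1 := by
  rw [← List.pairwise_map (f := Prod.fst) (R := (· ≤ ·)), map_fst_twoLine]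
  exact List.pairwise_insertionSort (· ≤ ·) w

theorem map_fst_twoLine_perm (w : List (Fin ℓ)) :
    ((twoLine w).map Prod.fst).Perm ((twoLine w).map Prod.snd) := by
  rw [map_fst_twoLine, map_snd_twoLine]
  exact List.perm_insertionSort _ _

theorem twoLine_map_snd {l : List (Fin ℓ × Fin ℓ)} (hl : l.Pairwise fun c d => c.1 ≤ d.1)
    (hp : (l.map Prod.fst).Perm (l.map Prod.snd)) : twoLine (l.map Prod.snd) = l := by
  have h : (l.map Prod.snd).insertionSort (· ≤ ·) = l.map Prod.fst :=
    List.Perm.eq_of_pairwise' (r := (· ≤ ·)) (List.pairwise_insertionSort _ _)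
      (List.pairwise_map.2 hl) ((List.perm_insertionSort _ _).trans hp.symm)
  rw [twoLine, h]
  exact (List.zip_of_prod rfl rfl).symm

instance : Std.Total fun c d : Fin ℓ × Fin ℓ => c.1 ≤ d.1 := ⟨fun c d => le_total c.1 d.1⟩

instance : IsTrans (Fin ℓ × Fin ℓ) fun c d => c.1 ≤ d.1 := ⟨fun _ _ _ => le_trans⟩

theorem twoLine_intercalation (u v : List (Fin ℓ)) :
    twoLine (intercalation u v) =
      (twoLine u ++ twoLine v).insertionSort (fun c d => c.1 ≤ d.1) := by
  have h := List.perm_insertionSort (fun c d : Fin ℓ × Fin ℓ => c.1 ≤ d.1)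
    (twoLine u ++ twoLine v)
  refine twoLine_map_snd (List.pairwise_insertionSort _ _) ?_
  refine (h.map _).trans (List.Perm.trans ?_ (h.map _).symm)
  rw [List.map_append, List.map_append]
  exact (map_fst_twoLine_perm u).append (map_fst_twoLine_perm v)

theorem length_intercalation (u v : List (Fin ℓ)) :
    (intercalation u v).length = u.length + v.length := by
  rw [← length_twoLine, twoLine_intercalation, List.length_insertionSort, List.length_append,
    length_twoLine, length_twoLine]

/-- The bottom entries of the columns with top entry `i`, from left to right. Intercalation
concatenates rows, which makes the family of rows the convenient form of a multiset permutation. -/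
def row (w : List (Fin ℓ)) (i : Fin ℓ) : List (Fin ℓ) :=
  ((twoLine w).filter (·.1 = i)).map Prod.snd

theorem map_row (w : List (Fin ℓ)) (i : Fin ℓ) :
    (row w i).map (Prod.mk i) = (twoLine w).filter (·.1 = i) := by
  rw [row, List.map_map]
  refine (List.map_congr_left fun c hc => ?_).trans (List.map_id _)
  have hci : c.1 = i := by simpa using (List.mem_filter.1 hc).2
  exact Prod.ext hci.symm rfl

theorem row_injective : Function.Injective (row (ℓ := ℓ)) := by
  intro u v h
  have : twoLine u = twoLine v :=
    eq_of_filter_key_eq (pairwise_fst_twoLine u) (pairwise_fst_twoLine v) fun i => by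
      rw [← map_row, ← map_row, h]
  rw [← map_snd_twoLine u, this, map_snd_twoLine]

theorem row_intercalation (u v : List (Fin ℓ)) (i : Fin ℓ) :
    row (intercalation u v) i = row u i ++ row v i := by
  have hsame : ((twoLine u ++ twoLine v).filter (·.1 = i)).Pairwise fun c d => c.1 ≤ d.1 :=
    List.pairwise_filter.2 (List.pairwise_of_forall fun c d => by simp +contextual)
  rw [row, twoLine_intercalation, filter_insertionSort_of_pairwise hsame, List.filter_append,
    List.map_append, row, row]

theorem row_nil (i : Fin ℓ) : row [] i = [] := rfl

theorem row_foldr_intercalation (L : List (List (Fin ℓ))) (i : Fin ℓ) :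
    row (L.foldr intercalation []) i = L.flatMap fun c => row c i := by
  induction L with
  | nil => rfl
  | cons c L ih => rw [List.foldr_cons, row_intercalation, ih, List.flatMap_cons]

theorem length_row (w : List (Fin ℓ)) (i : Fin ℓ) : (row w i).length = w.count i := by
  rw [row, List.length_map, ← List.countP_eq_length_filter,
    ← (List.perm_insertionSort (· ≤ ·) w).count_eq, ← map_fst_twoLine, List.count, List.countP_map]
  rfl

theorem sum_count_row (w : List (Fin ℓ)) (i : Fin ℓ) : ∑ j, (row w j).count i = w.count i := by
  simp only [row, List.count, List.countP_map, sum_countP_filter_key]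
  rw [← List.countP_map, map_snd_twoLine]

/-- A family of words is balanced if every letter `i` occurs in it as often as the length of
its `i`-th word says; these are the families of rows of multiset permutations. -/
def IsBalanced (f : Fin ℓ → List (Fin ℓ)) : Prop :=
  ∀ i, ∑ j, (f j).count i = (f i).length

theorem isBalanced_row (w : List (Fin ℓ)) : IsBalanced (row w) := fun i => by
  rw [sum_count_row, length_row]

theorem IsBalanced.of_append_left {f g : Fin ℓ → List (Fin ℓ)}
    (hfg : IsBalanced fun i => f i ++ g i) (hf : IsBalanced f) : IsBalanced g := by
  intro i
  have := hfg i
  simp only [List.count_append, Finset.sum_add_distrib, List.length_append, hf i] at this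
  exact Nat.add_left_cancel this

/-- The columns `(i, j)` with `j` running through `f i`, for increasing `i`. -/
def columns (f : Fin ℓ → List (Fin ℓ)) : List (Fin ℓ × Fin ℓ) :=
  (List.finRange ℓ).flatMap fun i => (f i).map (Prod.mk i)

theorem filter_fst_columns (f : Fin ℓ → List (Fin ℓ)) (i : Fin ℓ) :
    (columns f).filter (·.1 = i) = (f i).map (Prod.mk i) := by
  rw [columns, List.filter_flatMap, flatMap_eq_of_forall_ne (List.nodup_finRange ℓ)
    (List.mem_finRange i) fun j hj => by simp [hj]]
  simp

theorem pairwise_fst_columns (f : Fin ℓ → List (Fin ℓ)) :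
    (columns f).Pairwise fun c d => c.1 ≤ d.1 := by
  rw [columns, List.pairwise_flatMap]
  refine ⟨fun i _ => List.pairwise_map.2 (List.pairwise_of_forall fun _ _ => le_rfl),
    (List.pairwise_lt_finRange ℓ).imp fun {i j} hij c hc d hd => ?_⟩
  obtain ⟨_, -, rfl⟩ := List.mem_map.1 hc
  obtain ⟨_, -, rfl⟩ := List.mem_map.1 hd
  exact hij.le

theorem map_fst_columns_perm {f : Fin ℓ → List (Fin ℓ)} (hf : IsBalanced f) :
    ((columns f).map Prod.fst).Perm ((columns f).map Prod.snd) := by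
  rw [List.perm_iff_count]
  intro i
  have hfst : ((columns f).map Prod.fst).count i = (f i).length := by
    rw [← List.length_map (f := Prod.mk i), ← filter_fst_columns, ← List.countP_eq_length_filter,
      List.count, List.countP_map]
    rfl
  rw [hfst, ← hf, List.count, List.countP_map, ← sum_countP_filter_key Prod.fst]
  refine Finset.sum_congr rfl fun j _ => ?_
  rw [filter_fst_columns, List.countP_map]
  rfl

/-- The multiset permutation with a given balanced family of rows. -/
def ofRows (f : Fin ℓ → List (Fin ℓ)) : List (Fin ℓ) :=
  (columns f).map Prod.snd

theorem row_ofRows {f : Fin ℓ → List (Fin ℓ)} (hf : IsBalanced f) : row (ofRows f) = f := by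
  funext i
  rw [row, ofRows, twoLine_map_snd (pairwise_fst_columns f) (map_fst_columns_perm hf),
    filter_fst_columns, List.map_map]
  exact List.map_id _

end Rows

section Prime

theorem exists_isCycleOn_eqOn {α : Type*} [Finite α] {f : α → α} {A : Set α}
    (hA : A.Nonempty) (hf : Set.MapsTo f A A) :
    ∃ (σ : Equiv.Perm α) (S : Finset α),
      S.Nonempty ∧ (S : Set α) ⊆ A ∧ σ.IsCycleOn S ∧ Set.EqOn f σ S := by
  classical
  obtain ⟨a, ha⟩ := hA
  obtain ⟨x, hxA, hx⟩ : ∃ x ∈ A, x ∈ Function.periodicPts f := by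
    obtain ⟨m, n, hmn, h⟩ := Set.finite_univ.exists_lt_map_eq_of_forall_mem
      (f := fun n => f^[n] a) fun _ => Set.mem_univ _
    refine ⟨f^[m] a, hf.iterate m ha, n - m, Nat.sub_pos_of_lt hmn, ?_⟩
    rw [Function.IsPeriodicPt, Function.IsFixedPt, ← Function.iterate_add_apply,
      Nat.sub_add_cancel hmn.le]
    exact h.symm
  let orbit : List α := (List.range (Function.minimalPeriod f x)).map fun n => f^[n] x
  have hnodup : orbit.Nodup := Function.nodup_periodicOrbit
  have hlength : orbit.length = Function.minimalPeriod f x := by simp [orbit]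
  refine ⟨orbit.formPerm, orbit.toFinset, ⟨x, List.mem_toFinset.2 ?_⟩, ?_, ?_, ?_⟩
  · exact Function.self_mem_periodicOrbit hx
  · intro y hy
    obtain ⟨n, -, rfl⟩ := List.mem_map.1 (List.mem_toFinset.1 hy)
    exact hf.iterate n hxA
  · simpa using hnodup.isCycleOn_formPerm
  · intro y hy
    obtain ⟨n, hn, rfl⟩ := List.mem_iff_getElem.1 (List.mem_toFinset.1 hy)
    rw [List.formPerm_apply_getElem _ hnodup]
    simp only [hlength, orbit, List.getElem_map, List.getElem_range]
    rw [Function.iterate_mod_minimalPeriod_eq, Function.iterate_succ_apply']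

variable {ℓ : ℕ}

theorem foldr_intercalation_append (L L' : List (List (Fin ℓ))) :
    (L ++ L').foldr intercalation [] =
      intercalation (L.foldr intercalation []) (L'.foldr intercalation []) := by
  refine row_injective (funext fun i => ?_)
  simp only [row_intercalation, row_foldr_intercalation, List.flatMap_append]

theorem intercalation_nil (w : List (Fin ℓ)) : intercalation w [] = w :=
  row_injective (funext fun i => by rw [row_intercalation, row_nil, List.append_nil])

theorem exists_isPrimeDecomposition (w : List (Fin ℓ)) : ∃ L, IsPrimeDecomposition w L := by
  induction hn : w.length using Nat.strong_induction_on generalizing w with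
  | _ n ih =>
  by_cases hw : w = []
  · exact ⟨[], by simp, hw⟩
  by_cases hp : IsPrimeCycle w
  · exact ⟨[w], by simpa using hp, (intercalation_nil w).symm⟩
  · obtain ⟨u, v, rfl, hu, hv⟩ : ∃ u v, w = intercalation u v ∧ u ≠ [] ∧ v ≠ [] := by
      simpa [IsPrimeCycle, hw] using hp
    rw [length_intercalation] at hn
    have hu' := List.length_pos_iff.2 hu
    have hv' := List.length_pos_iff.2 hv
    obtain ⟨L, hL, hLu⟩ := ih u.length (by omega) u rfl
    obtain ⟨L', hL', hLv⟩ := ih v.length (by omega) v rfl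
    exact ⟨L ++ L', List.forall_mem_append.2 ⟨hL, hL'⟩, by
      rw [foldr_intercalation_append, ← hLu, ← hLv]⟩

theorem row_ne_nil_iff {w : List (Fin ℓ)} {i : Fin ℓ} : row w i ≠ [] ↔ i ∈ w := by
  rw [← List.length_pos_iff, length_row, List.count_pos_iff]

theorem mem_of_mem_row {w : List (Fin ℓ)} {i j : Fin ℓ} (h : j ∈ row w i) : j ∈ w := by
  rw [← map_snd_twoLine w]
  exact List.map_subset _ (List.filter_subset_self _) h

/-- The family of rows of the multiset permutation without repeated letters in which each
letter `i ∈ S` has the letter `σ i` below it. -/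
def permRows (σ : Equiv.Perm (Fin ℓ)) (S : Finset (Fin ℓ)) (i : Fin ℓ) : List (Fin ℓ) :=
  if i ∈ S then [σ i] else []

theorem isBalanced_permRows {σ : Equiv.Perm (Fin ℓ)} {S : Finset (Fin ℓ)}
    (hσ : ∀ i, σ i ∈ S ↔ i ∈ S) : IsBalanced (permRows σ S) := by
  intro i
  have hcount (j : Fin ℓ) :
      (permRows σ S j).count i = if σ j = i then if σ j ∈ S then 1 else 0 else 0 := by
    simp only [permRows, hσ]
    split_ifs <;> simp_all
  simp only [hcount]
  rw [Equiv.sum_comp σ fun k => if k = i then if k ∈ S then 1 else 0 else 0, Finset.sum_ite_eq',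
    if_pos (Finset.mem_univ i), permRows]
  split_ifs <;> rfl

theorem IsPrimeCycle.exists_isCycleOn {c : List (Fin ℓ)} (hc : IsPrimeCycle c) :
    ∃ (σ : Equiv.Perm (Fin ℓ)) (S : Finset (Fin ℓ)),
      S.Nonempty ∧ σ.IsCycleOn S ∧ row c = permRows σ S := by
  let next (i : Fin ℓ) : Fin ℓ := (row c i).headD i
  have row_eq_cons {i : Fin ℓ} (hi : i ∈ c) : row c i = next i :: (row c i).tail := by
    obtain ⟨j, t, hjt⟩ := List.exists_cons_of_ne_nil (row_ne_nil_iff.2 hi)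
    simp [next, hjt]
  have hnext : Set.MapsTo next {i | i ∈ c} {i | i ∈ c} := fun i hi =>
    mem_of_mem_row (i := i) (row_eq_cons hi ▸ List.mem_cons_self)
  obtain ⟨σ, S, hS, hSc, hσ, hnextσ⟩ :=
    exists_isCycleOn_eqOn (List.exists_mem_of_ne_nil c hc.1) hnext
  let rest (i : Fin ℓ) : List (Fin ℓ) := if i ∈ S then (row c i).tail else row c i
  have hsplit (i : Fin ℓ) : row c i = permRows σ S i ++ rest i := by
    by_cases hi : i ∈ S
    · simpa [permRows, rest, hi, ← hnextσ hi] using row_eq_cons (hSc hi)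
    · simp [permRows, rest, hi]
  have hbal : IsBalanced (permRows σ S) := isBalanced_permRows fun _ => hσ.apply_mem_iff
  have hrest : IsBalanced rest := .of_append_left (funext hsplit ▸ isBalanced_row c) hbal
  have hprod : c = intercalation (ofRows (permRows σ S)) (ofRows rest) := by
    refine row_injective (funext fun i => ?_)
    rw [row_intercalation, row_ofRows hbal, row_ofRows hrest, hsplit]
  refine ⟨σ, S, hS, hσ, ?_⟩
  obtain hnil | hnil := hc.2 _ _ hprod
  · obtain ⟨i, hi⟩ := hS
    have := congrFun (row_ofRows hbal) i
    simp [hnil, row_nil, permRows, hi] at this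
  · rw [hprod, hnil, intercalation_nil, row_ofRows hbal]

end Prime

section ChainUnion

theorem TransversePerm.exists_of_equiv_sigma {P ι : Type*} [PartialOrder P] [Preorder ι]
    {β : ι → Type*} [∀ m, Nonempty (β m)] (e : P ≃ Σ m, β m) (he : StrictMono fun x => (e x).1)
    (σ : ∀ m, Equiv.Perm (β m)) (hσ : ∀ m b c, (σ m).SameCycle b c) :
    ∃ τ : TransversePerm P, cyc τ.1 = Nat.card ι ∧ ∀ x, e (τ.1 x) = ⟨(e x).1, σ _ (e x).2⟩ := by
  let τ : Equiv.Perm P := e.symm.permCongr (Equiv.Perm.sigmaCongrRight σ)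
  have hτ (x : P) : e (τ x) = ⟨(e x).1, σ _ (e x).2⟩ := e.apply_symm_apply _
  have hfst (x : P) : (e (τ x)).1 = (e x).1 := by rw [hτ]
  have fst_eq {x y : P} (hxy : τ.SameCycle x y) : (e x).1 = (e y).1 :=
    apply_eq_of_sameCycle (h := fun x => (e x).1) hfst hxy
  have same_cycle_mk (m : ι) (b c : β m) : τ.SameCycle (e.symm ⟨m, b⟩) (e.symm ⟨m, c⟩) := by
    refine sameCycle_map (f := fun b => e.symm ⟨m, b⟩) (fun b => e.injective ?_) (hσ m b c)
    rw [hτ, e.apply_symm_apply, e.apply_symm_apply]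
  refine ⟨⟨τ, .of_strictMono he fun _ _ => fst_eq⟩,
    cyc_eq_natCard_of_sameCycle_iff (f := fun x => (e x).1) ?_ fun x y => ⟨fst_eq, ?_⟩, hτ⟩
  · exact Sigma.fst_surjective.comp e.surjective
  · intro hxy
    obtain ⟨⟨m, b⟩, rfl⟩ := e.symm.surjective x
    obtain ⟨⟨k, c⟩, rfl⟩ := e.symm.surjective y
    obtain rfl : m = k := by simpa using hxy
    exact same_cycle_mk m b c

theorem count_ofFn {α : Type*} [DecidableEq α] {n : ℕ} (f : Fin n → α) (i : α) :
    (List.ofFn f).count i = ∑ k, if f k = i then 1 else 0 := by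
  rw [← Finset.card_filter, List.ofFn_eq_map, ← Multiset.coe_count, ← Multiset.map_coe,
    Multiset.count_map]
  simp only [eq_comm]
  rfl

variable {ℓ : ℕ} {a : Fin ℓ → ℕ}

theorem ChainUnion.comparable_of_fst_eq {x y : ChainUnion a} (h : x.1 = y.1) : x ≤ y ∨ y ≤ x := by
  obtain ⟨i, k⟩ := x
  obtain ⟨_, m⟩ := y
  obtain rfl := h
  exact (le_total k m).imp (Sigma.LE.fiber _ _ _) (Sigma.LE.fiber _ _ _)

theorem sum_ite_fst_apply_eq {β : Type*} [Fintype β] (e : β ≃ ChainUnion a) (i : Fin ℓ) :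
    (∑ x, if (e x).1 = i then 1 else 0) = a i := by
  rw [e.sum_comp fun x : ChainUnion a => if x.1 = i then 1 else 0, Fintype.sum_sigma,
    Fintype.sum_eq_single i fun j hj => by simp [hj]]
  simp

/-- Chains of sizes `a i` realized as subsets `s i` of a linear order, which may overlap. -/
def chainUnionEquiv {β : Type*} [LinearOrder β] (s : Fin ℓ → Finset β)
    (hs : ∀ i, (s i).card = a i) : ChainUnion a ≃ Σ i, s i :=
  Equiv.sigmaCongrRight fun i => ((s i).orderIsoOfFin (hs i)).toEquiv

theorem chainUnionEquiv_strictMono {β : Type*} [LinearOrder β] (s : Fin ℓ → Finset β)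
    (hs : ∀ i, (s i).card = a i) : StrictMono fun x => ((chainUnionEquiv s hs x).2 : β) := by
  rintro _ _ ⟨i, k, m, hkm⟩
  exact ((s i).orderIsoOfFin (hs i)).strictMono hkm

theorem LinExt.range_symm_mk {n : ℕ} (σ : LinExt n (ChainUnion a)) (i : Fin ℓ) :
    Set.range (fun k : Fin (a i) => σ.1.symm ⟨i, k⟩) = {k | (σ.1 k).1 = i} := by
  ext k
  constructor
  · rintro ⟨m, rfl⟩
    exact congrArg Sigma.fst (σ.1.apply_symm_apply _)
  · rintro rfl
    exact ⟨(σ.1 k).2, σ.1.symm_apply_apply k⟩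

theorem multisetWord_injective {n : ℕ} :
    Function.Injective (multisetWord : LinExt n (ChainUnion a) → List (Fin ℓ)) := by
  intro σ σ' h
  have hfst (k : Fin n) : (σ.1 k).1 = (σ'.1 k).1 := congrFun (List.ofFn_injective h) k
  have hmono (σ : LinExt n (ChainUnion a)) (i : Fin ℓ) :
      StrictMono fun k : Fin (a i) => σ.1.symm ⟨i, k⟩ :=
    fun k m hkm => σ.2 _ _ (Sigma.LT.fiber _ _ _ hkm)
  have hsymm (i : Fin ℓ) :
      (fun k : Fin (a i) => σ.1.symm ⟨i, k⟩) = fun k => σ'.1.symm ⟨i, k⟩ := by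
    rw [← (hmono σ i).range_inj (hmono σ' i), LinExt.range_symm_mk, LinExt.range_symm_mk]
    simp only [hfst]
  exact Subtype.ext (Equiv.symm_bijective.injective
    (Equiv.ext fun x => congrFun (hsymm x.1) x.2))

theorem exists_multisetWord_eq_ofFn {n : ℕ} (w : Fin n → Fin ℓ)
    (hw : List.ofFn w ∈ multisetPerms a) :
    ∃ σ : LinExt n (ChainUnion a), multisetWord σ = List.ofFn w := by
  let s (i : Fin ℓ) : Finset (Fin n) := {k | w k = i}
  have hs (i : Fin ℓ) : (s i).card = a i := by
    rw [← hw i, count_ofFn, Finset.card_filter]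
  let e : ChainUnion a ≃ Fin n := (chainUnionEquiv s hs).trans <|
    (Equiv.sigmaCongrRight fun i => Equiv.subtypeEquivRight fun k => by simp [s]).trans
      (Equiv.sigmaFiberEquiv w)
  have he : StrictMono e := chainUnionEquiv_strictMono s hs
  have hwe (x : ChainUnion a) : w (e x) = x.1 :=
    (Finset.mem_filter.1 (chainUnionEquiv s hs x).2.2).2
  refine ⟨⟨e.symm, fun x y hxy => he hxy⟩, congrArg List.ofFn (funext fun k => ?_)⟩
  rw [← hwe, e.apply_symm_apply]

theorem length_of_mem_multisetPerms {w : List (Fin ℓ)} (hw : w ∈ multisetPerms a) :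
    w.length = ∑ i, a i := by
  rw [← Finset.sum_congr rfl fun i _ => hw i]
  simpa using (Multiset.sum_count_eq_card (m := (w : Multiset (Fin ℓ)))
    fun i _ => Finset.mem_univ i).symm

theorem bijOn_multisetWord {n : ℕ} (ha : ∑ i, a i = n) :
    Set.BijOn (multisetWord (n := n) (a := a)) Set.univ (multisetPerms a) := by
  refine ⟨fun σ _ i => ?_, multisetWord_injective.injOn, fun w hw => ?_⟩
  · rw [multisetWord, count_ofFn, sum_ite_fst_apply_eq]
  · obtain rfl : w.length = n := (length_of_mem_multisetPerms hw).trans ha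
    obtain ⟨σ, hσ⟩ := exists_multisetWord_eq_ofFn w.get (by rwa [List.ofFn_get])
    exact ⟨σ, Set.mem_univ σ, hσ.trans (List.ofFn_get w)⟩

/-- The multiset permutation whose `i`-th row lists the chains to which `τ` sends the elements of
the `i`-th chain. -/
def permWord (τ : Equiv.Perm (ChainUnion a)) : List (Fin ℓ) :=
  ofRows fun i => List.ofFn fun k => (τ ⟨i, k⟩).1

theorem row_permWord (τ : Equiv.Perm (ChainUnion a)) (i : Fin ℓ) :
    row (permWord τ) i = List.ofFn fun k => (τ ⟨i, k⟩).1 := by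
  rw [permWord, row_ofRows]
  intro i
  simp only [count_ofFn, List.length_ofFn]
  rw [← sum_ite_fst_apply_eq τ i, Fintype.sum_sigma]

theorem permWord_mem_multisetPerms (τ : Equiv.Perm (ChainUnion a)) :
    permWord τ ∈ multisetPerms a := fun i => by
  rw [← length_row, row_permWord, List.length_ofFn]

theorem TransversePerm.permWord_injective :
    Function.Injective fun τ : TransversePerm (ChainUnion a) => permWord τ.1 := by
  refine fun τ τ' h => eq_of_comparable fun x => ChainUnion.comparable_of_fst_eq ?_
  have hrow := congrArg (row · x.1) h
  simp only [row_permWord] at hrow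
  exact congrFun (List.ofFn_injective hrow) x.2

/-- The incidences of a family of finite sets, sorted by element or by set. -/
def incidenceEquiv {α ι : Type*} [DecidableEq α] [Fintype ι] (S : ι → Finset α) :
    (Σ i, ({m | i ∈ S m} : Finset ι)) ≃ Σ m, S m where
  toFun x := ⟨x.2, x.1, (Finset.mem_filter.1 x.2.2).2⟩
  invFun y := ⟨y.2, y.1, Finset.mem_filter.2 ⟨Finset.mem_univ _, y.2.2⟩⟩
  left_inv _ := rfl
  right_inv _ := rfl

theorem ofFn_orderEmbOfFin_filter {n k : ℕ} {p : Fin n → Prop} [DecidablePred p]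
    (h : ({m | p m} : Finset (Fin n)).card = k) :
    List.ofFn (Finset.orderEmbOfFin _ h) = (List.finRange n).filter p := by
  refine (Finset.orderEmbOfFin _ h).strictMono.sortedLT_ofFn.eq_of_mem_iff
    ((List.sortedLT_finRange n).pairwise.filter _).sortedLT fun m => ?_
  rw [List.mem_ofFn', Finset.range_orderEmbOfFin]
  simp

theorem flatMap_ite_singleton {α β : Type*} (l : List α) (p : α → Prop) [DecidablePred p]
    (f : α → β) : (l.flatMap fun x => if p x then [f x] else []) = (l.filter p).map f := by
  induction l with
  | nil => rfl
  | cons x l ih => by_cases hx : p x <;> simp [hx, ih]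

theorem IsPrimeDecomposition.exists_transversePerm {w : List (Fin ℓ)} {L : List (List (Fin ℓ))}
    (hL : IsPrimeDecomposition w L) (hw : w ∈ multisetPerms a) :
    ∃ τ : TransversePerm (ChainUnion a), permWord τ.1 = w ∧ cyc τ.1 = L.length := by
  choose σ S hS hσ hrow using fun m : Fin L.length => (hL.1 _ (L.get_mem m)).exists_isCycleOn
  have row_eq (i : Fin ℓ) :
      row w i = ((List.finRange L.length).filter (i ∈ S ·)).map fun m => σ m i := by
    have by_index : row w i = (List.finRange L.length).flatMap fun m => row (L.get m) i := by
      rw [← List.flatMap_map (f := L.get) (g := fun c => row c i), List.map_get_finRange, hL.2,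
        row_foldr_intercalation]
    simp only [by_index, hrow, permRows, flatMap_ite_singleton]
  let s (i : Fin ℓ) : Finset (Fin L.length) := {m | i ∈ S m}
  have hs (i : Fin ℓ) : (s i).card = a i := by
    rw [← hw i, ← length_row, row_eq, List.length_map, ← ofFn_orderEmbOfFin_filter rfl,
      List.length_ofFn]
  have (m : Fin L.length) : Nonempty (S m) := (hS m).to_subtype
  obtain ⟨τ, hcyc, hτ⟩ := TransversePerm.exists_of_equiv_sigma
    ((chainUnionEquiv s hs).trans (incidenceEquiv S)) (chainUnionEquiv_strictMono s hs)
    (fun m => (σ m).subtypePerm fun _ => (hσ m).apply_mem_iff)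
    fun m b c => (hσ m).subtypePerm.2 (Set.mem_univ b) (Set.mem_univ c)
  refine ⟨τ, row_injective (funext fun i => ?_), hcyc.trans (Nat.card_fin _)⟩
  rw [row_eq, row_permWord, ← ofFn_orderEmbOfFin_filter (hs i), List.map_ofFn]
  refine congrArg List.ofFn (funext fun k => ?_)
  exact congrArg (fun y => (y.2 : Fin ℓ)) (hτ ⟨i, k⟩)

theorem IsPrimeDecomposition.length_eq {w : List (Fin ℓ)} {L L' : List (List (Fin ℓ))}
    (hL : IsPrimeDecomposition w L) (hL' : IsPrimeDecomposition w L') : L.length = L'.length := by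
  obtain ⟨τ, hτ, hcyc⟩ := hL.exists_transversePerm (a := (w.count ·)) fun _ => rfl
  obtain ⟨τ', hτ', hcyc'⟩ := hL'.exists_transversePerm (a := (w.count ·)) fun _ => rfl
  rw [← hcyc, ← hcyc', TransversePerm.permWord_injective (hτ.trans hτ'.symm)]

theorem IsPrimeDecomposition.length_eq_fcyc {w : List (Fin ℓ)} {L : List (List (Fin ℓ))}
    (hL : IsPrimeDecomposition w L) : L.length = fcyc w := by
  have hne : {k | ∃ L, IsPrimeDecomposition w L ∧ L.length = k}.Nonempty := ⟨_, L, hL, rfl⟩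
  obtain ⟨L', hL', hlength⟩ := Nat.sInf_mem hne
  exact (hL.length_eq hL').trans hlength

theorem exists_transversePerm_of_mem_multisetPerms {w : List (Fin ℓ)} (hw : w ∈ multisetPerms a) :
    ∃ τ : TransversePerm (ChainUnion a), permWord τ.1 = w ∧ cyc τ.1 = fcyc w := by
  obtain ⟨L, hL⟩ := exists_isPrimeDecomposition w
  exact hL.length_eq_fcyc ▸ hL.exists_transversePerm hw

theorem TransversePerm.bijOn_permWord :
    Set.BijOn (fun τ : TransversePerm (ChainUnion a) => permWord τ.1) Set.univ
      (multisetPerms a) := by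
  refine ⟨fun τ _ => permWord_mem_multisetPerms τ.1, permWord_injective.injOn, fun w hw => ?_⟩
  obtain ⟨τ, hτ, -⟩ := exists_transversePerm_of_mem_multisetPerms hw
  exact ⟨τ, Set.mem_univ τ, hτ⟩

theorem TransversePerm.cyc_eq_fcyc_permWord (τ : TransversePerm (ChainUnion a)) :
    cyc τ.1 = fcyc (permWord τ.1) := by
  obtain ⟨τ', hτ', hcyc⟩ :=
    exists_transversePerm_of_mem_multisetPerms (permWord_mem_multisetPerms τ.1)
  rwa [permWord_injective hτ'] at hcyc

end ChainUnion

theorem exists_bijective_of_bijOn {α β γ : Type*} {f : α → γ} {g : β → γ} {t : Set γ}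
    (hf : Set.BijOn f Set.univ t) (hg : Set.BijOn g Set.univ t) :
    ∃ φ : α → β, Function.Bijective φ ∧ ∀ x, g (φ x) = f x := by
  let ψ : α ≃ β := (Equiv.Set.univ α).symm.trans <|
    (hf.equiv f).trans ((hg.equiv g).symm.trans (Equiv.Set.univ β))
  exact ⟨ψ, ψ.bijective, fun x => congrArg Subtype.val ((hg.equiv g).apply_symm_apply _)⟩

theorem theorem1p3 {ℓ n : ℕ} (a : Fin ℓ → ℕ) (ha : ∑ i, a i = n) :
    -- linear extensions are identified with multiset permutations
    Set.BijOn (multisetWord (n := n) (a := a)) Set.univ (multisetPerms a) ∧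
    -- the number of prime cycles is well defined
    (∀ σ : LinExt n (ChainUnion a),
      (∃ L, IsPrimeDecomposition (multisetWord σ) L) ∧
      ∀ L, IsPrimeDecomposition (multisetWord σ) L → L.length = fcyc (multisetWord σ)) ∧
    -- the bijection
    (∃ φ : LinExt n (ChainUnion a) → TransversePerm (ChainUnion a),
      Function.Bijective φ ∧ ∀ σ, cyc (φ σ).1 = fcyc (multisetWord σ)) ∧
    -- the Poincaré polynomial
    poin (ChainUnion a) =
      ∑ σ : LinExt n (ChainUnion a), Polynomial.X ^ (n - fcyc (multisetWord σ)) := by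
  obtain ⟨φ, hφ, hword⟩ :=
    exists_bijective_of_bijOn (bijOn_multisetWord ha) TransversePerm.bijOn_permWord
  have hcyc (σ : LinExt n (ChainUnion a)) : cyc (φ σ).1 = fcyc (multisetWord σ) := by
    rw [TransversePerm.cyc_eq_fcyc_permWord, hword]
  refine ⟨bijOn_multisetWord ha, fun σ => ⟨exists_isPrimeDecomposition _, fun L hL =>
    hL.length_eq_fcyc⟩, ⟨φ, hφ, hcyc⟩, ?_⟩
  have hcard : Nat.card (ChainUnion a) = n := by simpa using ha
  rw [poin_eq_sum_transversePerm, ← hφ.sum_comp, hcard]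
  simp only [hcyc]
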